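/- Let $K\ge 2$, $\sigma>0$, $B>0$, $0<c<\tfrac14$ and $H>0$. A $K$-armed bandit model is $\nu=(\nu_1,\dots,\nu_K)$, where $\nu_a$ is a probability measure on $\mathbb R$ with mean $\mu_a$. Put $\mathcal H(\nu)=\sum_{k\ne i}(\mu_i-\mu_k)^{-2}\in(0,\infty]$, where $i$ is an arm with the largest mean (the sum is $\infty$ if another arm has the same mean; the choice of $i$ does not matter). Let $\mathcal M_H$ be the set of models with $\mu_a\in[0,B]$ and $\nu_a$ $\sigma$-sub-Gaussian for every $a$, i.e. $\mathbb E_{\nu_a}[e^{t(X-\mu_a)}]\le e^{\sigma^2t^2/2}$ for all $t\in\mathbb R$, and $\mathcal H(\nu)\le H$. For a learner that makes $\tau$ pulls in total, each pull of arm $a$ giving an independent sample of $\nu_a$, and then recommends an arm $\hat I$, let $\mathcal R_1(\pi,\nu)=\mathbb P(\mu_{\hat I}\ne\max_a\mu_a)+c\,\mathbb E[\tau]$. The elimination algorithm DBCARE with budget function $N^*$ and confidence $\delta$ starts with $S=\{1,\dots,K\}$ and $n=0$. While $n\le N^*(|S|)$ and $|S|>1$, it increases $n$ by $1$, pulls each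 arm of $S$ once, computes for $k\in S$ the mean $\hat\mu_k(n)$ of the $n$ observations of arm $k$, and removes from $S$ all arms $k$ with $\max_{\ell\in S}\hat\mu_\ell(n)-\hat\mu_k(n)>\sqrt{4\sigma^2n^{-1}\log(Kn/\delta)}$. Then it recommends an arm of $S$ with the largest $\hat\mu_a(n)$, ties being broken uniformly at random. Let $\pi$ be DBCARE with $N^*(k)=(kec)^{-1}$ and $\delta=c\,(1+2c\log(K)N^*(2))^{-1}$, and let $$h_1(H)=\begin{cases}\frac{\sigma^2cH}{4}\log\!\left(\frac{e}{\sigma^2cH}\right), & H\le(\sigma^2c)^{-1},\\ \frac14, & H>(\sigma^2c)^{-1}.\end{cases}$$ Then $$\sup_{\nu\in\mathcal M_H}\mathcal R_1(\pi,\nu)\le 760\,\log(K)\,\log\!\left(\frac{K\log K}{ec^2}\right)h_1(H)+(K+1)c .$$ Consequently, up to the additive term, the worst-case risk is within a polylogarithmic factor of $h_1(H)$: there is an absolute constant $C$ such that, for all $K,\sigma,B,c,H$ as above, $\sup_{\nu\in\mathcal M_H}\mathcal R_1(\pi,\nu)\le C\log^2(K/c)\,h_1(H)+(K+1)c$. Moreover,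 for all $\sigma,B>0$ and $L$ there is a constant $C$ such that, for all $K,c,H$ as above with $Kc\le L$, $\sup_{\nu\in\mathcal M_H}\mathcal R_1(\pi,\nu)\le C\log^2(K/c)\,h_1(H)$. (Here a supremum over an empty class is $0$.) -/

import Mathlib

open MeasureTheory ProbabilityTheory
open scoped ENNReal

noncomputable section

namespace Bandit

/-! ### Bandit models -/

/-- A `K`-armed bandit model: one reward distribution on `ℝ` for each arm. -/
abbrev Model (K : ℕ) : Type := Fin K → ProbabilityMeasure ℝ

/-- The expected reward of arm `a`. -/
def armMean {K : ℕ} (ν : Model K) (a : Fin K) : ℝ :=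
  ∫ x, x ∂(ν a : Measure ℝ)

/-- `a` is an arm with the largest expected reward. -/
def IsBest {K : ℕ} (ν : Model K) (a : Fin K) : Prop :=
  ∀ k, armMean ν k ≤ armMean ν a

/-- A probability measure `lam` on `ℝ` is `σ`-sub-Gaussian:
`E exp (t (X - E X)) ≤ exp (σ ^ 2 t ^ 2 / 2)` for all real `t`, all these moments being finite. -/
def IsSubGaussian (σ : ℝ) (lam : ProbabilityMeasure ℝ) : Prop :=
  HasSubgaussianMGF (fun x : ℝ => x - ∫ y, y ∂(lam : Measure ℝ)) (σ ^ 2).toNNReal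
    (lam : Measure ℝ)

/-- The complexity `∑ Δ_k⁻²`, the sum being over all arms but one best arm, where `Δ_k` is the
gap between the largest mean and the mean of arm `k`. It is `∞` if some `Δ_k` in the sum is `0`.
The best arm that is left out does not matter, see `complexity_eq`. -/
def complexity {K : ℕ} (ν : Model K) : ℝ≥0∞ :=
  ⨅ (i : Fin K) (_ : IsBest ν i),
    ∑ k ∈ Finset.univ.erase i, (ENNReal.ofReal (armMean ν i - armMean ν k))⁻¹ ^ 2

theorem complexity_eq {K : ℕ} (ν : Model K) {i : Fin K} (hi : IsBest ν i) :
    complexity ν =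
      ∑ k ∈ Finset.univ.erase i, (ENNReal.ofReal (armMean ν i - armMean ν k))⁻¹ ^ 2 := by
  refine le_antisymm (iInf₂_le i hi) (le_iInf₂ fun j hj => ?_)
  rcases eq_or_ne i j with rfl | hij
  · exact le_rfl
  · have h0 : armMean ν j - armMean ν i ≤ 0 := sub_nonpos.2 (hi j)
    have htop : (ENNReal.ofReal (armMean ν j - armMean ν i))⁻¹ ^ 2 = ∞ := by
      simp [ENNReal.ofReal_of_nonpos h0]
    have hmem : i ∈ Finset.univ.erase j := by simp [hij]
    calc _ ≤ (∞ : ℝ≥0∞) := le_top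
      _ = (ENNReal.ofReal (armMean ν j - armMean ν i))⁻¹ ^ 2 := htop.symm
      _ ≤ _ := Finset.single_le_sum
          (f := fun k => (ENNReal.ofReal (armMean ν j - armMean ν k))⁻¹ ^ 2)
          (fun _ _ => zero_le) hmem

/-- The models with `σ`-sub-Gaussian arms, means in `[0, B]` and complexity at most `H`. -/
def modelClass (K : ℕ) (σ B H : ℝ) : Set (Model K) :=
  {ν | (∀ a, IsSubGaussian σ (ν a) ∧ armMean ν a ∈ Set.Icc 0 B) ∧
    complexity ν ≤ ENNReal.ofReal H}

/-! ### Interaction and risk -/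

/-- A table of rewards: `Y (a, s)` is what the learner observes at the `(s + 1)`-st pull of
arm `a`. -/
abbrev Rewards (K : ℕ) : Type := Fin K × ℕ → ℝ

/-- The law of the rewards under `ν`: all entries are independent, and the entries of arm `a`
have law `ν a`. -/
def rewardLaw {K : ℕ} (ν : Model K) : Measure (Rewards K) :=
  Measure.infinitePi fun p : Fin K × ℕ => (ν p.1 : Measure ℝ)

/-- The risk `P(arm Î is not best) + c E[τ]` of a learner that makes `τ` pulls in total and then
recommends a random arm `Î`, whose law given the rewards is `rec`. -/
def riskOne {K : ℕ} (c : ℝ) (ν : Model K) (τ : Rewards K → ℕ) (rec : Rewards K → PMF (Fin K)) :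
    ℝ≥0∞ :=
  (∫⁻ Y, (rec Y).toOuterMeasure {a | ¬ IsBest ν a} ∂(rewardLaw ν)) +
    ENNReal.ofReal c * ∫⁻ Y, (τ Y : ℝ≥0∞) ∂(rewardLaw ν)

/-! ### The elimination algorithm -/

/-- The variables of a run: number `n` of finished epochs, number `t` of pulls so far, and the
set `S` of surviving arms. -/
structure RunState (K : ℕ) where
  n : ℕ
  t : ℕ
  S : Finset (Fin K)

/-- The empirical mean of the first `n` observations of arm `k` (`0` if `n = 0`). Every arm that
takes part in epoch `n` has by then been pulled exactly `n` times, once in each epoch. -/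
def empMean {K : ℕ} (Y : Rewards K) (k : Fin K) (n : ℕ) : ℝ :=
  (∑ s ∈ Finset.range n, Y (k, s)) / n

/-- The width `e_n` of the confidence interval after epoch `n`. -/
def confWidth (K : ℕ) (σ δ : ℝ) (n : ℕ) : ℝ :=
  √(4 * σ ^ 2 / n * Real.log (K * n / δ))

/-- At the start no epoch is finished, nothing has been pulled, and every arm survives. -/
def initState (K : ℕ) : RunState K := ⟨0, 0, Finset.univ⟩

/-- The condition of the while loop, for the budget function `N`. -/
def Continues {K : ℕ} (N : ℕ → ℝ) (s : RunState K) : Prop :=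
  (s.n : ℝ) ≤ N s.S.card ∧ 1 < s.S.card

open Classical in
/-- One epoch: each surviving arm is pulled once, then every arm whose empirical mean is smaller
than the largest one of the surviving arms by more than the confidence width is removed. -/
def epoch {K : ℕ} (σ δ : ℝ) (Y : Rewards K) (s : RunState K) : RunState K where
  n := s.n + 1
  t := s.t + s.S.card
  S := s.S.filter fun k =>
    ¬ ∃ l ∈ s.S, empMean Y l (s.n + 1) - empMean Y k (s.n + 1) > confWidth K σ δ (s.n + 1)

open Classical in
/-- The while loop, unrolled: run an epoch if the loop condition holds, otherwise do nothing. -/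
def step {K : ℕ} (N : ℕ → ℝ) (σ δ : ℝ) (Y : Rewards K) (s : RunState K) : RunState K :=
  if Continues N s then epoch σ δ Y s else s

/-- A number of epochs after which the loop condition fails, see `not_continues_finalState`. -/
def maxEpochs (K : ℕ) (N : ℕ → ℝ) : ℕ :=
  ((Finset.range (K + 1)).sup fun k => ⌊N k⌋₊) + 1

/-- The state in which the while loop ends. -/
def finalState {K : ℕ} (N : ℕ → ℝ) (σ δ : ℝ) (Y : Rewards K) : RunState K :=
  (step N σ δ Y)^[maxEpochs K N] (initState K)

/-- The run really ends in `finalState`. -/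
theorem not_continues_finalState {K : ℕ} (N : ℕ → ℝ) (σ δ : ℝ) (Y : Rewards K) :
    ¬ Continues N (finalState N σ δ Y) := by
  have key : ∀ m, ¬ Continues N ((step N σ δ Y)^[m] (initState K)) ∨
      ((step N σ δ Y)^[m] (initState K)).n = m := by
    intro m
    induction m with
    | zero => right; rfl
    | succ m ih =>
      rw [Function.iterate_succ_apply']
      by_cases h : Continues N ((step N σ δ Y)^[m] (initState K))
      · right
        rw [step, if_pos h]
        simpa [epoch] using ih.resolve_left (not_not.2 h)
      · left
        rwa [step, if_neg h]
  rcases key (maxEpochs K N) with h | h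
  · exact h
  · rintro ⟨h1, -⟩
    have hcard : (finalState N σ δ Y).S.card ∈ Finset.range (K + 1) := by
      rw [Finset.mem_range, Nat.lt_succ_iff]
      simpa using Finset.card_le_univ (finalState N σ δ Y).S
    have h2 : maxEpochs K N ≤ ⌊N (finalState N σ δ Y).S.card⌋₊ := by
      rw [finalState, h] at h1
      exact Nat.le_floor h1
    have h3 := Finset.le_sup (f := fun k => ⌊N k⌋₊) hcard
    simp only [maxEpochs] at h2 h3
    omega

theorem finalState_nonempty {K : ℕ} (hK : 0 < K) (N : ℕ → ℝ) (σ δ : ℝ) (Y : Rewards K) :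
    (finalState N σ δ Y).S.Nonempty := by
  have key : ∀ m, ((step N σ δ Y)^[m] (initState K)).S.Nonempty := by
    intro m
    induction m with
    | zero => exact ⟨⟨0, hK⟩, Finset.mem_univ _⟩
    | succ m ih =>
      rw [Function.iterate_succ_apply']
      generalize (step N σ δ Y)^[m] (initState K) = s at ih
      unfold step
      split_ifs
      · obtain ⟨b, hb, hmax⟩ := s.S.exists_max_image (fun k => empMean Y k (s.n + 1)) ih
        refine ⟨b, Finset.mem_filter.2 ⟨hb, ?_⟩⟩
        rintro ⟨l, hl, h⟩
        have h1 := hmax l hl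
        have h2 : 0 ≤ confWidth K σ δ (s.n + 1) := Real.sqrt_nonneg _
        linarith
      · exact ih
  exact key _

open Classical in
/-- The surviving arms with the largest empirical mean at the end of the run. -/
def winners {K : ℕ} (N : ℕ → ℝ) (σ δ : ℝ) (Y : Rewards K) : Finset (Fin K) :=
  (finalState N σ δ Y).S.filter fun a =>
    ∀ l ∈ (finalState N σ δ Y).S,
      empMean Y l (finalState N σ δ Y).n ≤ empMean Y a (finalState N σ δ Y).n

theorem winners_nonempty {K : ℕ} (hK : 0 < K) (N : ℕ → ℝ) (σ δ : ℝ) (Y : Rewards K) :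
    (winners N σ δ Y).Nonempty := by
  obtain ⟨b, hb, hmax⟩ := (finalState N σ δ Y).S.exists_max_image
    (fun k => empMean Y k (finalState N σ δ Y).n) (finalState_nonempty hK N σ δ Y)
  exact ⟨b, Finset.mem_filter.2 ⟨hb, hmax⟩⟩

/-- The recommendation: a surviving arm with the largest empirical mean, ties being broken
uniformly at random. -/
def recommend {K : ℕ} (hK : 0 < K) (N : ℕ → ℝ) (σ δ : ℝ) (Y : Rewards K) : PMF (Fin K) :=
  PMF.uniformOfFinset (winners N σ δ Y) (winners_nonempty hK N σ δ Y)

/-- The risk of the elimination algorithm with budget function `N` and confidence `δ`. -/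
def dbcareRisk {K : ℕ} (hK : 0 < K) (N : ℕ → ℝ) (σ δ c : ℝ) (ν : Model K) : ℝ≥0∞ :=
  riskOne c ν (fun Y => (finalState N σ δ Y).t) (recommend hK N σ δ)

/-! ### The quantities in the bound -/

/-- The budget function `N(k) = 1 / (k e c)`. -/
def budget (c : ℝ) (k : ℕ) : ℝ := (k * Real.exp 1 * c)⁻¹

/-- The confidence `δ = c / (1 + 2 c log K N(2))`. -/
def confidence (K : ℕ) (c : ℝ) : ℝ :=
  c * (1 + 2 * c * Real.log K * budget c 2)⁻¹

/-- The lower bound on the worst-case risk. -/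
def hardness (σ c H : ℝ) : ℝ :=
  if H ≤ (σ ^ 2 * c)⁻¹ then
    σ ^ 2 * c * H / 4 * Real.log (Real.exp 1 / (σ ^ 2 * c * H))
  else 1 / 4

/-- The worst-case risk over the models of complexity at most `H` of the elimination algorithm,
run with the budget function `budget c` and the confidence `confidence K c`. -/
def worstCaseRisk {K : ℕ} (hK : 0 < K) (σ B c H : ℝ) : ℝ≥0∞ :=
  ⨆ ν ∈ modelClass K σ B H, dbcareRisk hK (budget c) σ (confidence K c) c ν

end Bandit

end

namespace Bandit

/-! ### Concentration of the empirical means -/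

/-! Write `G` for the sum of the inverse squared gaps to the best arm `i`, so `G ≤ H`, put `x =
σ²cH`, and let `L` be the logarithm in the explicit bound. The proof splits according to whether `64
e L x ≤ 1`.

If not, a trivial bound is enough: the error is at most `1`, and on every sample path the budget
limits the pulls to `K + (1 + log K)/(ec)` (`finalState_t_le_log`). In this regime `L * hardness` is
bounded below, so a multiple of `log K * L * hardness` absorbs the constant
(`const_le_mul_hardness`).

If `64 e L x ≤ 1`, every contribution except the first `K` pulls has to be proportional to `G`.
Three facts achieve this. Arm `i` is ever beaten with probability at most `4σ²δG/K`: both the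
confidence width and the gap enter the Hoeffding exponent, so the sum over all times converges
without a factor from the horizon (`rewardLaw_lost_le`). While `i` survives, each other survivor is
unresolved against `i`, and the expected number of unresolved pairs (arm, time) is at most `16σ²(Λ +
1)G` (`sum_rewardLaw_unresolved_le`). If `i` survives but is not isolated, the budget has run out,
which forces some arm to be unresolved later than its gap allows; this has probability at most
`32σ²G exp(-Λ/2)` (`exists_unresolved_late`, `sum_rewardLaw_unresolved_late_le`). With `Λ = 2L` and
the given `δ`, these add up to `Kc + O(L)σ²cG`, and `hardness` is at least `x/4`.

For the last claim, gaps are at most `B`, so a nonempty class has `K - 1 ≤ B²H`, and the cost of the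
first pulls is itself `O(hardness)` when `Kc` is bounded. -/

instance {K : ℕ} (ν : Model K) : IsProbabilityMeasure (rewardLaw ν) := by
  unfold rewardLaw; infer_instance

@[fun_prop]
theorem measurable_empMean {K : ℕ} (k : Fin K) (n : ℕ) :
    Measurable fun Y : Rewards K => empMean Y k n := by
  unfold empMean; fun_prop

theorem hasSubgaussianMGF_reward {K : ℕ} {σ : ℝ} {ν : Model K} {p : Fin K × ℕ}
    (h : IsSubGaussian σ (ν p.1)) :
    HasSubgaussianMGF (fun Y : Rewards K => Y p - armMean ν p.1) (σ ^ 2).toNNReal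
      (rewardLaw ν) := by
  have hmap : (rewardLaw ν).map (fun Y => Y p) = (ν p.1 : Measure ℝ) :=
    (measurePreserving_eval_infinitePi (fun p : Fin K × ℕ => (ν p.1 : Measure ℝ)) p).map_eq
  have h1 : HasSubgaussianMGF (fun x : ℝ => x - armMean ν p.1) (σ ^ 2).toNNReal
      ((rewardLaw ν).map (fun Y => Y p)) := by
    rw [hmap]; exact h
  have hm : Measurable fun Y : Rewards K => Y p := measurable_pi_apply p
  exact h1.of_map hm.aemeasurable

/-- Hoeffding's inequality for the difference of the empirical means of two arms. -/
theorem rewardLaw_diff_ge_le {K : ℕ} {σ : ℝ} {ν : Model K} (h : ∀ a, IsSubGaussian σ (ν a))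
    {k l : Fin K} (hkl : k ≠ l) {n : ℕ} (hn : 1 ≤ n) {t : ℝ} (ht : 0 ≤ t) :
    rewardLaw ν {Y | t ≤ (empMean Y l n - armMean ν l) - (empMean Y k n - armMean ν k)} ≤
      ENNReal.ofReal (Real.exp (-(n * t ^ 2 / (4 * σ ^ 2)))) := by
  classical
  -- Signed centred rewards: `n` times the difference of the two centred means is a sum of `2n`
  -- independent sub-Gaussian terms, with total variance proxy `2nσ²`.
  set X : Fin K × ℕ → ℝ → ℝ := fun p y =>
    if p.1 = l then y - armMean ν p.1 else -(y - armMean ν p.1) with hX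
  have hmeas : ∀ p, Measurable (X p) := fun p => by
    simp only [hX]; split_ifs <;> fun_prop
  have hind : iIndepFun (fun p (Y : Rewards K) => X p (Y p)) (rewardLaw ν) :=
    iIndepFun_infinitePi hmeas
  have hsub : ∀ p, HasSubgaussianMGF (fun Y : Rewards K => X p (Y p)) (σ ^ 2).toNNReal
      (rewardLaw ν) := fun p => by
    have h1 := hasSubgaussianMGF_reward (p := p) (h p.1)
    by_cases hp : p.1 = l
    · simpa [hX, hp] using h1
    · simp only [hX, if_neg hp]
      exact h1.neg
  have hn0 : (0 : ℝ) < n := by exact_mod_cast hn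
  have key := HasSubgaussianMGF.measure_sum_ge_le_of_iIndepFun hind
    (s := ({l, k} : Finset (Fin K)) ×ˢ Finset.range n) (fun p _ => hsub p) (ε := n * t)
    (by positivity)
  have hsum : ∀ Y : Rewards K,
      ∑ p ∈ ({l, k} : Finset (Fin K)) ×ˢ Finset.range n, X p (Y p) =
        n * ((empMean Y l n - armMean ν l) - (empMean Y k n - armMean ν k)) := fun Y => by
    rw [Finset.sum_product, Finset.sum_pair hkl.symm]
    simp only [hX, if_true, if_neg hkl, empMean, Finset.sum_neg_distrib, Finset.sum_sub_distrib,
      Finset.sum_const, Finset.card_range, nsmul_eq_mul]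
    field_simp
    ring
  have hset : {Y : Rewards K | t ≤ (empMean Y l n - armMean ν l) - (empMean Y k n - armMean ν k)}
      = {Y | n * t ≤ ∑ p ∈ ({l, k} : Finset (Fin K)) ×ˢ Finset.range n, X p (Y p)} := by
    ext Y
    simp only [Set.mem_ofPred_eq, hsum]
    exact (mul_le_mul_iff_right₀ hn0).symm
  rw [hset, ← ENNReal.ofReal_toReal (measure_ne_top (rewardLaw ν) _)]
  refine ENNReal.ofReal_le_ofReal (key.trans (le_of_eq ?_))
  congr 1
  have hcard : (({l, k} : Finset (Fin K)) ×ˢ Finset.range n).card = 2 * n := by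
    rw [Finset.card_product, Finset.card_pair hkl.symm, Finset.card_range]
  have hc : ((∑ p ∈ ({l, k} : Finset (Fin K)) ×ˢ Finset.range n, (σ ^ 2).toNNReal :
      NNReal) : ℝ) = 2 * n * σ ^ 2 := by
    rw [Finset.sum_const, hcard]
    simp [Real.coe_toNNReal _ (sq_nonneg σ)]
  rw [hc]
  rcases eq_or_ne σ 0 with rfl | hσ
  · simp
  · field_simp
    ring

/-! ### Elementary sums -/

/-- Telescoping: `1 + a ≤ exp a` gives `a * exp (-(m+1)a) ≤ exp (-ma) - exp (-(m+1)a)`. -/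
theorem sum_exp_neg_mul_le {a : ℝ} (ha : 0 < a) (M : ℕ) :
    ∑ n ∈ Finset.Icc 1 M, Real.exp (-(n * a)) ≤ 1 / a := by
  have key : ∀ M : ℕ, a * ∑ n ∈ Finset.Icc 1 M, Real.exp (-(n * a)) ≤ 1 - Real.exp (-(M * a)) := by
    intro M
    induction M with
    | zero => simp
    | succ m ih =>
      rw [Finset.sum_Icc_succ_top (by omega), mul_add]
      have h1 : Real.exp (-(m * a)) = Real.exp (-((m + 1 : ℕ) * a)) * Real.exp a := by
        rw [← Real.exp_add]; push_cast; ring_nf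
      have h2 : a + 1 ≤ Real.exp a := Real.add_one_le_exp a
      have h3 := Real.exp_pos (-((m + 1 : ℕ) * a))
      rw [h1] at ih
      nlinarith
  rw [le_div_iff₀ ha, mul_comm]
  exact (key M).trans (by linarith [Real.exp_pos (-(M * a))])

theorem card_filter_Icc_one_le {b : ℝ} (hb : 0 ≤ b) (M : ℕ) (p : ℕ → Prop) [DecidablePred p]
    (hp : ∀ n, p n → (n : ℝ) ≤ b) : (((Finset.Icc 1 M).filter p).card : ℝ) ≤ b := by
  have h : (Finset.Icc 1 M).filter p ⊆ Finset.Icc 1 ⌊b⌋₊ := fun n hn => by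
    simp only [Finset.mem_filter, Finset.mem_Icc] at hn ⊢
    exact ⟨hn.1.1, Nat.le_floor (hp n hn.2)⟩
  have h1 := Finset.card_le_card h
  rw [Nat.card_Icc, Nat.add_sub_cancel] at h1
  exact (Nat.cast_le.2 h1).trans (Nat.floor_le hb)

/-! ### Two kinds of events -/

/-- After `n` observations arm `k` looks better than arm `i` by more than the confidence width. -/
def beaten {K : ℕ} (σ δ : ℝ) (i k : Fin K) (n : ℕ) : Set (Rewards K) :=
  {Y | confWidth K σ δ n < empMean Y k n - empMean Y i n}

/-- After `n` observations arm `i` does not look better than arm `k` by more than the confidence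
width. -/
def unresolved {K : ℕ} (σ δ : ℝ) (i k : Fin K) (n : ℕ) : Set (Rewards K) :=
  {Y | empMean Y i n - empMean Y k n ≤ confWidth K σ δ n}

/-- At some time up to `M`, arm `i` is beaten by another arm. -/
def lost {K : ℕ} (σ δ : ℝ) (i : Fin K) (M : ℕ) : Set (Rewards K) :=
  ⋃ k ∈ Finset.univ.erase i, ⋃ n ∈ Finset.Icc 1 M, beaten σ δ i k n

theorem measurableSet_beaten {K : ℕ} (σ δ : ℝ) (i k : Fin K) (n : ℕ) :
    MeasurableSet (beaten σ δ i k n) :=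
  measurableSet_lt measurable_const (by fun_prop)

theorem measurableSet_unresolved {K : ℕ} (σ δ : ℝ) (i k : Fin K) (n : ℕ) :
    MeasurableSet (unresolved σ δ i k n) :=
  measurableSet_le (by fun_prop) measurable_const

theorem measurableSet_lost {K : ℕ} (σ δ : ℝ) (i : Fin K) (M : ℕ) :
    MeasurableSet (lost σ δ i M) :=
  Finset.measurableSet_biUnion _ fun _ _ =>
    Finset.measurableSet_biUnion _ fun _ _ => measurableSet_beaten ..

theorem not_mem_lost {K : ℕ} {σ δ : ℝ} {i : Fin K} {M : ℕ} {Y : Rewards K}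
    (h : Y ∉ lost σ δ i M) {k : Fin K} (hk : k ≠ i) {n : ℕ} (h1 : 1 ≤ n) (hn : n ≤ M) :
    empMean Y k n - empMean Y i n ≤ confWidth K σ δ n := by
  by_contra hlt
  refine h (Set.mem_biUnion (x := k) (by simpa using hk) (Set.mem_biUnion (x := n) (by simp [h1, hn]) ?_))
  exact not_le.1 hlt

/-! ### Probabilities of these events, summed over arms and times -/

section Probabilities

variable {K : ℕ} {σ δ : ℝ} {ν : Model K} {i k : Fin K}

/-- To be beaten, the centred difference must exceed width plus gap, and `(e + Δ)² ≥ e² + Δ²`. The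
width contributes the factor `δ/(Kn) ≤ δ/K`; the gap contributes the decay that makes the sum over
`n` finite. -/
theorem rewardLaw_beaten_le (hσ : 0 < σ) (hδ : 0 < δ) (hδ1 : δ ≤ 1)
    (hν : ∀ a, IsSubGaussian σ (ν a)) (hki : k ≠ i) (hΔ : armMean ν k ≤ armMean ν i)
    {n : ℕ} (hn : 1 ≤ n) :
    rewardLaw ν (beaten σ δ i k n) ≤ ENNReal.ofReal
      (δ / K * Real.exp (-(n * ((armMean ν i - armMean ν k) ^ 2 / (4 * σ ^ 2))))) := by
  set Δ := armMean ν i - armMean ν k with hΔdef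
  have hΔ0 : 0 ≤ Δ := sub_nonneg.2 hΔ
  set e := confWidth K σ δ n with he
  have he0 : 0 ≤ e := Real.sqrt_nonneg _
  have hK : (1 : ℝ) ≤ K := by exact_mod_cast (Nat.zero_lt_of_lt i.2 : 0 < K)
  have hn1 : (1 : ℝ) ≤ n := by exact_mod_cast hn
  -- Makes the logarithm nonnegative, so that squaring `confWidth` really undoes the square root.
  have hone : 1 ≤ K * n / δ := by
    rw [le_div_iff₀ hδ]; nlinarith
  have hlog := Real.log_nonneg hone
  have he2 : e ^ 2 = 4 * σ ^ 2 / n * Real.log (K * n / δ) := Real.sq_sqrt (by positivity)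
  have hsub : beaten σ δ i k n ⊆
      {Y | e + Δ ≤ (empMean Y k n - armMean ν k) - (empMean Y i n - armMean ν i)} := fun Y hY => by
    have : e < empMean Y k n - empMean Y i n := hY
    simp only [Set.mem_ofPred_eq]
    linarith
  refine (measure_mono hsub).trans
    ((rewardLaw_diff_ge_le hν hki.symm hn (by positivity)).trans (ENNReal.ofReal_le_ofReal ?_))
  have hsq : n * (e ^ 2 + Δ ^ 2) / (4 * σ ^ 2) ≤ n * (e + Δ) ^ 2 / (4 * σ ^ 2) := by
    gcongr; nlinarith [mul_nonneg he0 hΔ0]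
  calc Real.exp (-(n * (e + Δ) ^ 2 / (4 * σ ^ 2)))
      ≤ Real.exp (-(n * (e ^ 2 + Δ ^ 2) / (4 * σ ^ 2))) := by
        gcongr
    _ = Real.exp (-Real.log (K * n / δ)) * Real.exp (-(n * (Δ ^ 2 / (4 * σ ^ 2)))) := by
        rw [← Real.exp_add, he2]
        congr 1
        field_simp
        ring
    _ ≤ _ := by
        rw [Real.exp_neg, Real.exp_log (by positivity), inv_div]
        gcongr
        nlinarith

/-- Once `nΔ² ≥ 16σ²Λ`, the width is at most `Δ/2`, so staying unresolved requires a deviation of at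
least `Δ/2`. -/
theorem rewardLaw_unresolved_le {Λ : ℝ} (hν : ∀ a, IsSubGaussian σ (ν a)) (hki : k ≠ i)
    (hΔ : armMean ν k ≤ armMean ν i) {n : ℕ} (hn : 1 ≤ n)
    (hlog : Real.log (K * n / δ) ≤ Λ)
    (hlarge : 16 * σ ^ 2 * Λ ≤ n * (armMean ν i - armMean ν k) ^ 2) :
    rewardLaw ν (unresolved σ δ i k n) ≤ ENNReal.ofReal
      (Real.exp (-(n * ((armMean ν i - armMean ν k) ^ 2 / (16 * σ ^ 2))))) := by
  set Δ := armMean ν i - armMean ν k with hΔdef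
  have hΔ0 : 0 ≤ Δ := sub_nonneg.2 hΔ
  have hn0 : (0 : ℝ) < n := by exact_mod_cast hn
  have he : confWidth K σ δ n ≤ Δ / 2 := by
    refine Real.sqrt_le_iff.2 ⟨by positivity, ?_⟩
    calc 4 * σ ^ 2 / n * Real.log (K * n / δ) ≤ 4 * σ ^ 2 / n * Λ := by gcongr
      _ = 16 * σ ^ 2 * Λ / (4 * n) := by field_simp; ring
      _ ≤ n * Δ ^ 2 / (4 * n) := by gcongr
      _ = (Δ / 2) ^ 2 := by field_simp; ring
  have hsub : unresolved σ δ i k n ⊆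
      {Y | Δ / 2 ≤ (empMean Y k n - armMean ν k) - (empMean Y i n - armMean ν i)} := fun Y hY => by
    have : empMean Y i n - empMean Y k n ≤ confWidth K σ δ n := hY
    simp only [Set.mem_ofPred_eq]
    linarith
  refine (measure_mono hsub).trans
    ((rewardLaw_diff_ge_le hν hki.symm hn (by positivity)).trans (le_of_eq ?_))
  congr 3
  rcases eq_or_ne σ 0 with rfl | hσ
  · simp
  · field_simp
    ring

/-- The sum of the inverse squared gaps to arm `i`. -/
noncomputable def invGapSum (ν : Model K) (i : Fin K) : ℝ :=
  ∑ k ∈ Finset.univ.erase i, ((armMean ν i - armMean ν k) ^ 2)⁻¹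

theorem rewardLaw_lost_le (hσ : 0 < σ) (hδ : 0 < δ) (hδ1 : δ ≤ 1)
    (hν : ∀ a, IsSubGaussian σ (ν a)) (hi : ∀ k, k ≠ i → armMean ν k < armMean ν i) (M : ℕ) :
    rewardLaw ν (lost σ δ i M) ≤ ENNReal.ofReal (δ / K * (4 * σ ^ 2) * invGapSum ν i) := by
  unfold lost invGapSum
  refine (measure_biUnion_finset_le _ _).trans ?_
  rw [Finset.mul_sum, ENNReal.ofReal_sum_of_nonneg (fun k _ => by positivity)]
  refine Finset.sum_le_sum fun k hk => ?_
  have hki : k ≠ i := Finset.ne_of_mem_erase hk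
  have hpos : 0 < armMean ν i - armMean ν k := sub_pos.2 (hi k hki)
  refine (measure_biUnion_finset_le _ _).trans ?_
  calc ∑ n ∈ Finset.Icc 1 M, rewardLaw ν (beaten σ δ i k n)
      ≤ ∑ n ∈ Finset.Icc 1 M, ENNReal.ofReal
          (δ / K * Real.exp (-(n * ((armMean ν i - armMean ν k) ^ 2 / (4 * σ ^ 2))))) :=
        Finset.sum_le_sum fun n hn =>
          rewardLaw_beaten_le hσ hδ hδ1 hν hki (hi k hki).le (Finset.mem_Icc.1 hn).1
    _ = ENNReal.ofReal (δ / K * ∑ n ∈ Finset.Icc 1 M,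
          Real.exp (-(n * ((armMean ν i - armMean ν k) ^ 2 / (4 * σ ^ 2))))) := by
        rw [Finset.mul_sum, ENNReal.ofReal_sum_of_nonneg (fun k _ => by positivity)]
    _ ≤ _ := by
        refine ENNReal.ofReal_le_ofReal ?_
        rw [mul_assoc]
        gcongr
        refine (sum_exp_neg_mul_le (by positivity) M).trans (le_of_eq ?_)
        field_simp

/-- For each arm, the at most `16σ²Λ/Δ²` early times are counted with probability `1`; the later
ones sum to at most `16σ²/Δ²`. -/
theorem sum_rewardLaw_unresolved_le {Λ : ℝ} (hσ : 0 < σ) (hΛ : 0 ≤ Λ)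
    (hν : ∀ a, IsSubGaussian σ (ν a)) (hi : ∀ k, k ≠ i → armMean ν k < armMean ν i) {M : ℕ}
    (hlog : ∀ n ∈ Finset.Icc 1 M, Real.log (K * n / δ) ≤ Λ) :
    ∑ k ∈ Finset.univ.erase i, ∑ n ∈ Finset.Icc 1 M, rewardLaw ν (unresolved σ δ i k n) ≤
      ENNReal.ofReal (16 * σ ^ 2 * (Λ + 1) * invGapSum ν i) := by
  classical
  unfold invGapSum
  rw [Finset.mul_sum, ENNReal.ofReal_sum_of_nonneg (fun k _ => by positivity)]
  refine Finset.sum_le_sum fun k hk => ?_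
  have hki : k ≠ i := Finset.ne_of_mem_erase hk
  set Δ := armMean ν i - armMean ν k with hΔ
  have hpos : 0 < Δ := sub_pos.2 (hi k hki)
  calc ∑ n ∈ Finset.Icc 1 M, rewardLaw ν (unresolved σ δ i k n)
      ≤ ∑ n ∈ Finset.Icc 1 M, ENNReal.ofReal
          ((if (n : ℝ) ≤ 16 * σ ^ 2 * Λ / Δ ^ 2 then 1 else 0) +
            Real.exp (-(n * (Δ ^ 2 / (16 * σ ^ 2))))) := by
        refine Finset.sum_le_sum fun n hn => ?_
        split_ifs with h
        · refine prob_le_one.trans ?_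
          rw [← ENNReal.ofReal_one]
          exact ENNReal.ofReal_le_ofReal (by linarith [Real.exp_pos (-(n * (Δ ^ 2 / (16 * σ ^ 2))))])
        · rw [zero_add]
          refine rewardLaw_unresolved_le hν hki (hi k hki).le (Finset.mem_Icc.1 hn).1 (hlog n hn) ?_
          rw [not_le, div_lt_iff₀ (by positivity)] at h
          exact h.le
    _ = ENNReal.ofReal (((Finset.Icc 1 M).filter fun n : ℕ => (n : ℝ) ≤ 16 * σ ^ 2 * Λ / Δ ^ 2).card
          + ∑ n ∈ Finset.Icc 1 M, Real.exp (-(n * (Δ ^ 2 / (16 * σ ^ 2))))) := by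
        rw [← ENNReal.ofReal_sum_of_nonneg (fun n _ => by positivity), Finset.sum_add_distrib,
          Finset.sum_boole]
    _ ≤ _ := by
        refine ENNReal.ofReal_le_ofReal ?_
        refine (add_le_add (card_filter_Icc_one_le (by positivity) M _ fun n h => h)
          (sum_exp_neg_mul_le (by positivity) M)).trans (le_of_eq ?_)
        field_simp

/-- The exponent `nΔ²/(16σ²)` is at least `Λ` at late times. One half of it yields `exp(-Λ/2)`, the
other half is kept to sum over `n`. -/
theorem sum_rewardLaw_unresolved_late_le {Λ : ℝ} (hσ : 0 < σ)
    (hν : ∀ a, IsSubGaussian σ (ν a)) (hi : ∀ k, k ≠ i → armMean ν k < armMean ν i) {M : ℕ}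
    (hlog : ∀ n ∈ Finset.Icc 1 M, Real.log (K * n / δ) ≤ Λ) :
    ∑ k ∈ Finset.univ.erase i, ∑ n ∈ Finset.Icc 1 M,
        rewardLaw ν {Y | 16 * σ ^ 2 * Λ ≤ n * (armMean ν i - armMean ν k) ^ 2 ∧
          Y ∈ unresolved σ δ i k n} ≤
      ENNReal.ofReal (Real.exp (-(Λ / 2)) * (32 * σ ^ 2) * invGapSum ν i) := by
  unfold invGapSum
  rw [Finset.mul_sum, ENNReal.ofReal_sum_of_nonneg (fun k _ => by positivity)]
  refine Finset.sum_le_sum fun k hk => ?_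
  have hki : k ≠ i := Finset.ne_of_mem_erase hk
  set Δ := armMean ν i - armMean ν k with hΔ
  have hpos : 0 < Δ := sub_pos.2 (hi k hki)
  calc ∑ n ∈ Finset.Icc 1 M,
        rewardLaw ν {Y | 16 * σ ^ 2 * Λ ≤ n * Δ ^ 2 ∧ Y ∈ unresolved σ δ i k n}
      ≤ ∑ n ∈ Finset.Icc 1 M, ENNReal.ofReal
          (Real.exp (-(Λ / 2)) * Real.exp (-(n * (Δ ^ 2 / (32 * σ ^ 2))))) := by
        refine Finset.sum_le_sum fun n hn => ?_
        by_cases h : 16 * σ ^ 2 * Λ ≤ n * Δ ^ 2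
        · simp only [h, true_and, Set.ofPred_mem_eq]
          refine (rewardLaw_unresolved_le hν hki (hi k hki).le (Finset.mem_Icc.1 hn).1
            (hlog n hn) h).trans (ENNReal.ofReal_le_ofReal ?_)
          rw [← Real.exp_add]
          refine Real.exp_le_exp.2 ?_
          have h2 : Λ / 2 ≤ n * (Δ ^ 2 / (32 * σ ^ 2)) := by
            rw [← mul_div_assoc, le_div_iff₀ (by positivity)]
            linarith
          have h3 : n * (Δ ^ 2 / (16 * σ ^ 2)) = 2 * (n * (Δ ^ 2 / (32 * σ ^ 2))) := by
            field_simp; ring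
          linarith
        · simp [h]
    _ = ENNReal.ofReal (Real.exp (-(Λ / 2)) *
          ∑ n ∈ Finset.Icc 1 M, Real.exp (-(n * (Δ ^ 2 / (32 * σ ^ 2))))) := by
        rw [Finset.mul_sum, ENNReal.ofReal_sum_of_nonneg (fun k _ => by positivity)]
    _ ≤ _ := by
        refine ENNReal.ofReal_le_ofReal ?_
        rw [mul_assoc]
        gcongr
        refine (sum_exp_neg_mul_le (by positivity) M).trans (le_of_eq ?_)
        field_simp

end Probabilities

/-! ### A run of the algorithm -/

section Run

variable {K : ℕ} {σ δ c : ℝ} {Y : Rewards K} {i : Fin K}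

theorem finalState_induction {N : ℕ → ℝ} {P : RunState K → Prop} (h0 : P (initState K))
    (hs : ∀ s, P s → Continues N s → P (epoch σ δ Y s)) : P (finalState N σ δ Y) := by
  unfold finalState
  induction maxEpochs K N with
  | zero => exact h0
  | succ m ih =>
    rw [Function.iterate_succ_apply']
    unfold step
    split_ifs with h
    · exact hs _ ih h
    · exact ih

theorem budget_pos (hc : 0 < c) {k : ℕ} (hk : 1 ≤ k) : 0 < budget c k := by
  have : (0 : ℝ) < k := by exact_mod_cast hk
  unfold budget; positivity

theorem budget_anti (hc : 0 < c) {j k : ℕ} (hj : 1 ≤ j) (hjk : j ≤ k) :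
    budget c k ≤ budget c j := by
  have h1 : (0 : ℝ) < j := by exact_mod_cast hj
  unfold budget
  gcongr

/-- A bound on the number of epochs that are run with the budget function `budget c`. -/
noncomputable def epochBound (c : ℝ) : ℕ := ⌊budget c 2⌋₊ + 1

/-- The properties that every state of a run with the budget function `budget c` has. -/
structure Reachable (σ δ c : ℝ) (Y : Rewards K) (s : RunState K) : Prop where
  n_le : s.n ≤ epochBound c
  sep : 1 ≤ s.n → ∀ k ∈ s.S, ∀ l ∈ s.S,
    empMean Y l s.n - empMean Y k s.n ≤ confWidth K σ δ s.n

theorem reachable_init : Reachable σ δ c Y (initState K) where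
  n_le := Nat.zero_le _
  sep h := absurd h (by simp [initState])

theorem Reachable.epoch_n_le (hc : 0 < c) {s : RunState K} (hs : Continues (budget c) s) :
    s.n + 1 ≤ epochBound c :=
  Nat.add_le_add_right (Nat.le_floor (hs.1.trans (budget_anti hc (by norm_num) hs.2))) 1

theorem Reachable.epoch (hc : 0 < c) {s : RunState K} (hs : Continues (budget c) s) :
    Reachable σ δ c Y (epoch σ δ Y s) where
  n_le := Reachable.epoch_n_le hc hs
  sep _ k hk l hl := by
    by_contra h
    exact (Finset.mem_filter.1 hk).2 ⟨l, (Finset.mem_filter.1 hl).1, not_le.1 h⟩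

theorem mem_epoch (hc : 0 < c) (hY : Y ∉ lost σ δ i (epochBound c)) {s : RunState K}
    (hs : Continues (budget c) s) (his : i ∈ s.S) : i ∈ (epoch σ δ Y s).S := by
  refine Finset.mem_filter.2 ⟨his, ?_⟩
  rintro ⟨l, hl, h⟩
  have h0 : 0 ≤ confWidth K σ δ (s.n + 1) := Real.sqrt_nonneg _
  rcases eq_or_ne l i with rfl | hli
  · linarith
  · linarith [not_mem_lost hY hli (Nat.le_add_left 1 s.n) (Reachable.epoch_n_le hc hs)]

/-- The number of pulls, bounded in terms of the number of survivors in each epoch. -/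
theorem finalState_t_le (hc : 0 < c) {P : RunState K → Prop} (h0 : P (initState K))
    (hs : ∀ s, P s → Continues (budget c) s → P (epoch σ δ Y s)) (f : ℕ → ℕ)
    (hf : ∀ s, P s → Continues (budget c) s → 1 ≤ s.n → s.S.card ≤ f s.n) :
    (finalState (budget c) σ δ Y).t ≤ K + ∑ n ∈ Finset.Icc 1 (epochBound c), f n := by
  have key : P (finalState (budget c) σ δ Y) ∧
      (finalState (budget c) σ δ Y).n ≤ epochBound c ∧
      ((finalState (budget c) σ δ Y).n = 0 ∧ (finalState (budget c) σ δ Y).t = 0 ∨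
        1 ≤ (finalState (budget c) σ δ Y).n ∧ (finalState (budget c) σ δ Y).t ≤
          K + ∑ n ∈ Finset.Ico 1 (finalState (budget c) σ δ Y).n, f n) := by
    refine finalState_induction (P := fun s => P s ∧ s.n ≤ epochBound c ∧
      (s.n = 0 ∧ s.t = 0 ∨ 1 ≤ s.n ∧ s.t ≤ K + ∑ n ∈ Finset.Ico 1 s.n, f n))
      ⟨h0, Nat.zero_le _, Or.inl ⟨rfl, rfl⟩⟩ ?_
    rintro s ⟨hP, -, h⟩ hcont
    refine ⟨hs s hP hcont, Reachable.epoch_n_le hc hcont, Or.inr ⟨Nat.le_add_left 1 s.n, ?_⟩⟩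
    change s.t + s.S.card ≤ K + ∑ n ∈ Finset.Ico 1 (s.n + 1), f n
    rcases h with ⟨hn, ht⟩ | ⟨hn, ht⟩
    -- Before the first epoch there are no observations to compare, so that epoch is charged in
    -- full.
    · have : s.S.card ≤ K := by simpa using Finset.card_le_univ s.S
      omega
    · rw [Finset.sum_Ico_succ_top hn]
      have := hf s hP hcont hn
      omega
  obtain ⟨-, hn, ⟨-, ht⟩ | ⟨-, ht⟩⟩ := key
  · omega
  · refine ht.trans (Nat.add_le_add_left (Finset.sum_le_sum_of_subset fun n hn' => ?_) K)
    rw [Finset.mem_Ico] at hn'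
    exact Finset.mem_Icc.2 ⟨hn'.1, by omega⟩

/-- An epoch entered at time `n` with `m` survivors has `n ≤ budget c j` for all `1 ≤ j ≤ m`, so `m`
is at most the number of such `j ≤ K`. Exchanging the sums over `n` and `j` leaves a harmonic sum.
-/
theorem finalState_t_le_log (hc : 0 < c) :
    ((finalState (budget c) σ δ Y).t : ℝ) ≤ K + (1 + Real.log K) / (Real.exp 1 * c) := by
  classical
  have h := finalState_t_le (σ := σ) (δ := δ) (Y := Y) hc (P := fun _ => True) trivial
    (fun _ _ _ => trivial)
    (fun n => ∑ j ∈ Finset.Icc 1 K, if (n : ℝ) ≤ budget c j then 1 else 0) ?_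
  · have h' : ((finalState (budget c) σ δ Y).t : ℝ) ≤ K + ∑ j ∈ Finset.Icc 1 K,
        (((Finset.Icc 1 (epochBound c)).filter fun n : ℕ => (n : ℝ) ≤ budget c j).card : ℝ) := by
      rw [Finset.sum_comm] at h
      simp only [Finset.sum_boole] at h
      exact_mod_cast h
    refine h'.trans (add_le_add le_rfl ?_)
    calc ∑ j ∈ Finset.Icc 1 K,
          (((Finset.Icc 1 (epochBound c)).filter fun n : ℕ => (n : ℝ) ≤ budget c j).card : ℝ)
        ≤ ∑ j ∈ Finset.Icc 1 K, budget c j := Finset.sum_le_sum fun j hj =>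
          card_filter_Icc_one_le (budget_pos hc (Finset.mem_Icc.1 hj).1).le _ _ fun n h => h
      _ = (harmonic K : ℝ) / (Real.exp 1 * c) := by
          rw [harmonic_eq_sum_Icc]
          push_cast
          rw [Finset.sum_div]
          refine Finset.sum_congr rfl fun j _ => ?_
          unfold budget
          rw [mul_assoc, mul_inv, div_eq_mul_inv]
      _ ≤ _ := by
          gcongr
          exact harmonic_le_one_add_log K
  · rintro s - hs hn
    rw [Finset.sum_boole, Nat.cast_id]
    have hsub : Finset.Icc 1 s.S.card ⊆
        (Finset.Icc 1 K).filter fun j => (s.n : ℝ) ≤ budget c j := fun j hj => by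
      have hcard : s.S.card ≤ K := by simpa using Finset.card_le_univ s.S
      rw [Finset.mem_Icc] at hj
      exact Finset.mem_filter.2 ⟨Finset.mem_Icc.2 ⟨hj.1, hj.2.trans hcard⟩,
        hs.1.trans (budget_anti hc hj.1 hj.2)⟩
    simpa using Finset.card_le_card hsub

/-- Survivors of an epoch are pairwise within the confidence width, in particular unresolved against
`i`. The loop runs only with `m ≥ 2` survivors, whence `m ≤ 2(m - 1)` and the factor `2`. -/
theorem finalState_t_le_unresolved (hc : 0 < c) (hY : Y ∉ lost σ δ i (epochBound c)) :
    ((finalState (budget c) σ δ Y).t : ℝ≥0∞) ≤ K + 2 * ∑ k ∈ Finset.univ.erase i,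
      ∑ n ∈ Finset.Icc 1 (epochBound c), (unresolved σ δ i k n).indicator 1 Y := by
  classical
  have h := finalState_t_le (σ := σ) (δ := δ) (Y := Y) hc
    (P := fun s => i ∈ s.S ∧ Reachable σ δ c Y s) ⟨Finset.mem_univ i, reachable_init⟩
    (fun s hs hcont => ⟨mem_epoch hc hY hcont hs.1, Reachable.epoch hc hcont⟩)
    (fun n => 2 * ∑ k ∈ Finset.univ.erase i, if Y ∈ unresolved σ δ i k n then 1 else 0) ?_
  · rw [← Finset.mul_sum, Finset.sum_comm] at h
    have h' := (Nat.cast_le (α := ℝ≥0∞)).2 h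
    push_cast at h'
    simpa [Set.indicator_apply] using h'
  · rintro s ⟨his, hs⟩ hcont hn
    rw [Finset.sum_boole, Nat.cast_id]
    have hsub : s.S.erase i ⊆
        (Finset.univ.erase i).filter fun k => Y ∈ unresolved σ δ i k s.n := fun k hk => by
      rw [Finset.mem_erase] at hk
      exact Finset.mem_filter.2 ⟨by simp [hk.1], hs.sep hn k hk.2 i his⟩
    have h1 := Finset.card_le_card hsub
    have h2 := Finset.card_erase_of_mem his
    have h3 := hcont.2
    omega

/-- If the best arm is never beaten and the gaps are large compared with the budget, then a run
that does not isolate the best arm leaves an arm unresolved which should have been resolved. -/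
theorem exists_unresolved_late (hc : 0 < c) {Λ : ℝ} {Δ : Fin K → ℝ}
    (hΔ : ∀ k, k ≠ i → 0 < Δ k)
    (hsmall : 32 * σ ^ 2 * Λ * ∑ k ∈ Finset.univ.erase i, (Δ k ^ 2)⁻¹ ≤ (Real.exp 1 * c)⁻¹)
    (hΛ : 0 ≤ Λ)
    (hY : Y ∉ lost σ δ i (epochBound c)) (hne : (finalState (budget c) σ δ Y).S ≠ {i}) :
    ∃ k ∈ Finset.univ.erase i, ∃ n ∈ Finset.Icc 1 (epochBound c),
      16 * σ ^ 2 * Λ ≤ n * Δ k ^ 2 ∧ Y ∈ unresolved σ δ i k n := by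
  have hinv : i ∈ (finalState (budget c) σ δ Y).S ∧
      Reachable σ δ c Y (finalState (budget c) σ δ Y) :=
    finalState_induction (P := fun s => i ∈ s.S ∧ Reachable σ δ c Y s)
      ⟨Finset.mem_univ i, reachable_init⟩
      fun s hs hcont => ⟨mem_epoch hc hY hcont hs.1, Reachable.epoch hc hcont⟩
  have hfinal := not_continues_finalState (budget c) σ δ Y
  generalize finalState (budget c) σ δ Y = s at hinv hfinal hne
  obtain ⟨his, hs⟩ := hinv
  have hcard : 1 < s.S.card := by
    by_contra h
    exact hne (Finset.eq_singleton_iff_unique_mem.2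
      ⟨his, fun k hk => Finset.card_le_one.1 (not_lt.1 h) k hk i his⟩)
  have hn : budget c s.S.card < s.n := by
    by_contra h
    exact hfinal ⟨not_lt.1 h, hcard⟩
  have hn1 : 1 ≤ s.n := by
    have := (budget_pos hc hcard.le).trans hn
    exact_mod_cast this
  by_contra! hall
  have hcard0 : (0 : ℝ) < s.S.card := by exact_mod_cast (by omega : 0 < s.S.card)
  -- The loop stopped with several survivors, so the budget is exhausted. As it is inversely
  -- proportional to the number of survivors, this bounds the product `n * m` from below.
  have hexp : (Real.exp 1 * c)⁻¹ < s.n * s.S.card := by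
    have h1 : budget c s.S.card = (Real.exp 1 * c)⁻¹ / s.S.card := by
      unfold budget
      rw [mul_assoc, mul_inv, div_eq_mul_inv, mul_comm]
    rwa [h1, div_lt_iff₀ hcard0] at hn
  have hlt : ∀ k ∈ s.S.erase i, (s.n : ℝ) ≤ 16 * σ ^ 2 * Λ * (Δ k ^ 2)⁻¹ := fun k hk => by
    rw [Finset.mem_erase] at hk
    have hpos := hΔ k hk.1
    rw [← div_eq_mul_inv, le_div_iff₀ (by positivity)]
    by_contra hle
    exact hall k (by simp [hk.1]) s.n (Finset.mem_Icc.2 ⟨hn1, hs.n_le⟩) (not_le.1 hle).le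
      (hs.sep hn1 k hk.2 i his)
  have hsum : ((s.S.erase i).card : ℝ) * s.n ≤
      16 * σ ^ 2 * Λ * ∑ k ∈ Finset.univ.erase i, (Δ k ^ 2)⁻¹ := by
    rw [← nsmul_eq_mul, Finset.mul_sum]
    refine (Finset.card_nsmul_le_sum _ _ _ hlt).trans
      (Finset.sum_le_sum_of_subset_of_nonneg (Finset.erase_subset_erase i (Finset.subset_univ _))
        fun k _ _ => by positivity)
  -- If no survivor is late, then `n * m ≤ 2n(m - 1) ≤ 32σ²ΛG ≤ 1/(ec)`, contradicting `hexp`.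
  have hhalf : (s.S.card : ℝ) ≤ 2 * (s.S.erase i).card := by
    have := Finset.card_erase_of_mem his
    exact_mod_cast (by omega : s.S.card ≤ 2 * (s.S.erase i).card)
  have hn0 : (0 : ℝ) ≤ s.n := Nat.cast_nonneg _
  nlinarith [mul_le_mul_of_nonneg_left hhalf hn0]

theorem recommend_error_eq_zero (hK : 0 < K) {N : ℕ → ℝ} {ν : Model K} (hi : IsBest ν i)
    (h : (finalState N σ δ Y).S = {i}) :
    (recommend hK N σ δ Y).toOuterMeasure {a | ¬ IsBest ν a} = 0 := by
  rw [PMF.toOuterMeasure_apply_eq_zero_iff, recommend, PMF.support_uniformOfFinset,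
    Set.disjoint_left]
  intro a ha hbad
  have : a ∈ (finalState N σ δ Y).S := (Finset.mem_filter.1 ha).1
  rw [h, Finset.mem_singleton] at this
  exact hbad (this ▸ hi)

end Run

/-! ### The risk on one model -/

section Risk

variable {K : ℕ} {σ δ c Λ : ℝ} {ν : Model K} {i : Fin K}

theorem invGapSum_nonneg (ν : Model K) (i : Fin K) : 0 ≤ invGapSum ν i :=
  Finset.sum_nonneg fun _ _ => by positivity

theorem toOuterMeasure_le_one {α : Type*} (p : PMF α) (s : Set α) : p.toOuterMeasure s ≤ 1 := by
  rw [PMF.toOuterMeasure_apply, ← p.tsum_coe]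
  exact ENNReal.tsum_le_tsum fun a => Set.indicator_le_self s p a

theorem log_nat_nonneg (K : ℕ) : 0 ≤ Real.log K := Real.log_natCast_nonneg K

theorem lintegral_error_le_one (hK : 0 < K) (N : ℕ → ℝ) :
    ∫⁻ Y, (recommend hK N σ δ Y).toOuterMeasure {a | ¬ IsBest ν a} ∂(rewardLaw ν) ≤ 1 := by
  calc _ ≤ ∫⁻ _, 1 ∂(rewardLaw ν) := lintegral_mono fun Y => toOuterMeasure_le_one _ _
    _ = 1 := by simp

/-- The error probability is dominated pointwise by the indicator of the measurable event that `i`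
is beaten or some arm is unresolved late; elsewhere `i` is the only survivor. -/
theorem lintegral_error_le (hK : 0 < K) (hσ : 0 < σ) (hc : 0 < c) (hδ : 0 < δ) (hδ1 : δ ≤ 1)
    (hν : ∀ a, IsSubGaussian σ (ν a)) (hi : ∀ k, k ≠ i → armMean ν k < armMean ν i)
    (hΛ : 0 ≤ Λ) (hlog : ∀ n ∈ Finset.Icc 1 (epochBound c), Real.log (K * n / δ) ≤ Λ)
    (hsmall : 32 * σ ^ 2 * Λ * invGapSum ν i ≤ (Real.exp 1 * c)⁻¹) :
    ∫⁻ Y, (recommend hK (budget c) σ δ Y).toOuterMeasure {a | ¬ IsBest ν a} ∂(rewardLaw ν) ≤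
      ENNReal.ofReal (δ / K * (4 * σ ^ 2) * invGapSum ν i +
        Real.exp (-(Λ / 2)) * (32 * σ ^ 2) * invGapSum ν i) := by
  classical
  have hG := invGapSum_nonneg ν i
  have hbest : IsBest ν i := fun k => by
    rcases eq_or_ne k i with rfl | h
    · exact le_rfl
    · exact (hi k h).le
  set D : Fin K → ℕ → Set (Rewards K) := fun k n =>
    {Y | 16 * σ ^ 2 * Λ ≤ n * (armMean ν i - armMean ν k) ^ 2 ∧ Y ∈ unresolved σ δ i k n} with hD
  set A : Set (Rewards K) := lost σ δ i (epochBound c) ∪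
    ⋃ k ∈ Finset.univ.erase i, ⋃ n ∈ Finset.Icc 1 (epochBound c), D k n with hA
  have hDm : ∀ k n, MeasurableSet (D k n) := fun k n =>
    (MeasurableSet.const _).inter (measurableSet_unresolved σ δ i k n)
  have hAm : MeasurableSet A := (measurableSet_lost ..).union
    (Finset.measurableSet_biUnion _ fun _ _ => Finset.measurableSet_biUnion _ fun _ _ => hDm ..)
  calc _ ≤ ∫⁻ Y, A.indicator 1 Y ∂(rewardLaw ν) := by
        refine lintegral_mono fun Y => ?_
        by_cases hY : Y ∈ A
        · simp only [Set.indicator_of_mem hY, Pi.one_apply]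
          exact toOuterMeasure_le_one _ _
        · rw [Set.indicator_of_notMem hY, nonpos_iff_eq_zero]
          refine recommend_error_eq_zero hK hbest ?_
          by_contra hne
          obtain ⟨k, hk, n, hn, hkn⟩ := exists_unresolved_late hc
            (Δ := fun k => armMean ν i - armMean ν k) (fun k hk => sub_pos.2 (hi k hk))
            hsmall hΛ (fun h => hY (Or.inl h)) hne
          exact hY (Or.inr (Set.mem_biUnion hk (Set.mem_biUnion hn hkn)))
    _ = rewardLaw ν A := lintegral_indicator_one hAm
    _ ≤ rewardLaw ν (lost σ δ i (epochBound c)) + ∑ k ∈ Finset.univ.erase i,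
          ∑ n ∈ Finset.Icc 1 (epochBound c), rewardLaw ν (D k n) := by
        refine (measure_union_le _ _).trans (add_le_add le_rfl ?_)
        refine (measure_biUnion_finset_le _ _).trans (Finset.sum_le_sum fun k _ => ?_)
        exact measure_biUnion_finset_le _ _
    _ ≤ _ := by
        rw [ENNReal.ofReal_add (by positivity) (by positivity)]
        exact add_le_add (rewardLaw_lost_le hσ hδ hδ1 hν hi _)
          (sum_rewardLaw_unresolved_late_le hσ hν hi hlog)

/-- The pathwise bound from the budget is used only where `i` has been beaten, so it is weighted by
the small probability of that event. -/
theorem lintegral_pulls_le (hσ : 0 < σ) (hc : 0 < c) (hδ : 0 < δ) (hδ1 : δ ≤ 1)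
    (hν : ∀ a, IsSubGaussian σ (ν a)) (hi : ∀ k, k ≠ i → armMean ν k < armMean ν i)
    (hΛ : 0 ≤ Λ) (hlog : ∀ n ∈ Finset.Icc 1 (epochBound c), Real.log (K * n / δ) ≤ Λ) :
    ∫⁻ Y, ((finalState (budget c) σ δ Y).t : ℝ≥0∞) ∂(rewardLaw ν) ≤
      ENNReal.ofReal (K + (1 + Real.log K) / (Real.exp 1 * c) *
        (δ / K * (4 * σ ^ 2) * invGapSum ν i) + 32 * σ ^ 2 * (Λ + 1) * invGapSum ν i) := by
  have hG := invGapSum_nonneg ν i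
  have hlK := log_nat_nonneg K
  have hL := measurableSet_lost σ δ i (epochBound c)
  set C : ℝ := (1 + Real.log K) / (Real.exp 1 * c) with hC
  have hC0 : 0 ≤ C := by positivity
  have hI : Measurable ((lost σ δ i (epochBound c)).indicator (1 : Rewards K → ℝ≥0∞)) :=
    measurable_one.indicator hL
  have hU : ∀ k n, Measurable ((unresolved σ δ i k n).indicator (1 : Rewards K → ℝ≥0∞)) :=
    fun k n => measurable_one.indicator (measurableSet_unresolved σ δ i k n)
  calc _ ≤ ∫⁻ Y, (K + ENNReal.ofReal C * (lost σ δ i (epochBound c)).indicator 1 Y +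
          2 * ∑ k ∈ Finset.univ.erase i, ∑ n ∈ Finset.Icc 1 (epochBound c),
            (unresolved σ δ i k n).indicator 1 Y) ∂(rewardLaw ν) := by
        refine lintegral_mono fun Y => ?_
        by_cases hY : Y ∈ lost σ δ i (epochBound c)
        · refine le_add_right ?_
          simp only [Set.indicator_of_mem hY, Pi.one_apply, mul_one]
          rw [← ENNReal.ofReal_natCast, ← ENNReal.ofReal_natCast K,
            ← ENNReal.ofReal_add (Nat.cast_nonneg K) hC0]
          exact ENNReal.ofReal_le_ofReal (finalState_t_le_log hc)
        · simp only [Set.indicator_of_notMem hY, mul_zero, add_zero]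
          exact finalState_t_le_unresolved hc hY
    _ = K + ENNReal.ofReal C * rewardLaw ν (lost σ δ i (epochBound c)) +
          2 * ∑ k ∈ Finset.univ.erase i, ∑ n ∈ Finset.Icc 1 (epochBound c),
            rewardLaw ν (unresolved σ δ i k n) := by
        rw [lintegral_add_left, lintegral_add_left measurable_const, lintegral_const,
          lintegral_const_mul _ hI, lintegral_indicator_one hL,
          lintegral_const_mul, lintegral_finsetSum]
        · simp only [measure_univ, mul_one]
          congr 2
          refine Finset.sum_congr rfl fun k _ => ?_
          rw [lintegral_finsetSum _ fun n _ => hU k n]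
          exact Finset.sum_congr rfl fun n _ =>
            lintegral_indicator_one (measurableSet_unresolved σ δ i k n)
        · exact fun k _ => Finset.measurable_fun_sum _ fun n _ => hU k n
        · exact Finset.measurable_fun_sum _ fun k _ => Finset.measurable_fun_sum _ fun n _ => hU k n
        · exact measurable_const.add (measurable_const.mul hI)
    _ ≤ K + ENNReal.ofReal C * ENNReal.ofReal (δ / K * (4 * σ ^ 2) * invGapSum ν i) +
          2 * ENNReal.ofReal (16 * σ ^ 2 * (Λ + 1) * invGapSum ν i) := by
        gcongr
        · exact rewardLaw_lost_le hσ hδ hδ1 hν hi _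
        · exact sum_rewardLaw_unresolved_le hσ hΛ hν hi hlog
    _ = _ := by
        rw [← ENNReal.ofReal_natCast K, ← ENNReal.ofReal_mul hC0,
          ← ENNReal.ofReal_ofNat 2, ← ENNReal.ofReal_mul (by norm_num),
          ← ENNReal.ofReal_add (Nat.cast_nonneg K) (by positivity),
          ← ENNReal.ofReal_add (by positivity) (by positivity)]
        congr 1
        ring

theorem lintegral_pulls_le_log (hc : 0 < c) :
    ∫⁻ Y, ((finalState (budget c) σ δ Y).t : ℝ≥0∞) ∂(rewardLaw ν) ≤
      ENNReal.ofReal (K + (1 + Real.log K) / (Real.exp 1 * c)) := by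
  calc _ ≤ ∫⁻ _, ENNReal.ofReal (K + (1 + Real.log K) / (Real.exp 1 * c)) ∂(rewardLaw ν) := by
        refine lintegral_mono fun Y => ?_
        rw [← ENNReal.ofReal_natCast]
        exact ENNReal.ofReal_le_ofReal (finalState_t_le_log hc)
    _ = _ := by simp

/-- The risk bound that holds for all models. -/
theorem dbcareRisk_le_log (hK : 0 < K) (hc : 0 < c) :
    dbcareRisk hK (budget c) σ δ c ν ≤
      ENNReal.ofReal (1 + K * c + (1 + Real.log K) / Real.exp 1) := by
  have hlK := log_nat_nonneg K
  calc _ ≤ 1 + ENNReal.ofReal c * ENNReal.ofReal (K + (1 + Real.log K) / (Real.exp 1 * c)) := by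
        unfold dbcareRisk riskOne
        gcongr
        · exact lintegral_error_le_one hK _
        · exact lintegral_pulls_le_log hc
    _ = _ := by
        rw [← ENNReal.ofReal_one, ← ENNReal.ofReal_mul hc.le,
          ← ENNReal.ofReal_add zero_le_one (by positivity)]
        congr 1
        field_simp
        ring

/-- The risk bound for models with large gaps. -/
theorem dbcareRisk_le (hK : 0 < K) (hσ : 0 < σ) (hc : 0 < c) (hδ : 0 < δ) (hδ1 : δ ≤ 1)
    (hν : ∀ a, IsSubGaussian σ (ν a)) (hi : ∀ k, k ≠ i → armMean ν k < armMean ν i)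
    (hΛ : 0 ≤ Λ) (hlog : ∀ n ∈ Finset.Icc 1 (epochBound c), Real.log (K * n / δ) ≤ Λ)
    (hsmall : 32 * σ ^ 2 * Λ * invGapSum ν i ≤ (Real.exp 1 * c)⁻¹) :
    dbcareRisk hK (budget c) σ δ c ν ≤
      ENNReal.ofReal (K * c + (4 * (δ * (1 + (1 + Real.log K) / Real.exp 1)) / K +
        32 * Real.exp (-(Λ / 2)) + 32 * (Λ + 1) * c) * (σ ^ 2 * invGapSum ν i)) := by
  have hG := invGapSum_nonneg ν i
  have hlK := log_nat_nonneg K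
  unfold dbcareRisk riskOne
  refine (add_le_add (lintegral_error_le hK hσ hc hδ hδ1 hν hi hΛ hlog hsmall)
    (mul_le_mul_right (lintegral_pulls_le hσ hc hδ hδ1 hν hi hΛ hlog) _)).trans (le_of_eq ?_)
  rw [← ENNReal.ofReal_mul hc.le, ← ENNReal.ofReal_add (by positivity) (by positivity)]
  congr 1
  have : (0 : ℝ) < K := by exact_mod_cast hK
  field_simp
  ring

end Risk

/-! ### Models of bounded complexity -/

section ModelClass

variable {K : ℕ} {σ B H : ℝ} {ν : Model K}

/-- Finite complexity rules out a second best arm, since a zero gap would contribute `∞`; the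
extended sum is then an ordinary real one. -/
theorem exists_best_of_mem_modelClass (hK : 0 < K) (hH : 0 ≤ H) (hν : ν ∈ modelClass K σ B H) :
    ∃ i, (∀ k, k ≠ i → armMean ν k < armMean ν i) ∧ invGapSum ν i ≤ H := by
  have : Nonempty (Fin K) := ⟨⟨0, hK⟩⟩
  obtain ⟨i, hi⟩ := Finite.exists_max (armMean ν)
  have hsum := hν.2
  rw [complexity_eq ν hi] at hsum
  have hgap : ∀ k, k ≠ i → armMean ν k < armMean ν i := fun k hk => by
    by_contra hle
    have h1 := (Finset.single_le_sum
      (f := fun k => (ENNReal.ofReal (armMean ν i - armMean ν k))⁻¹ ^ 2)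
      (fun _ _ => zero_le) (Finset.mem_erase.2 ⟨hk, Finset.mem_univ k⟩)).trans hsum
    rw [ENNReal.ofReal_of_nonpos (sub_nonpos.2 (not_lt.1 hle))] at h1
    simp at h1
  refine ⟨i, hgap, ?_⟩
  have heq : ∑ k ∈ Finset.univ.erase i, (ENNReal.ofReal (armMean ν i - armMean ν k))⁻¹ ^ 2 =
      ENNReal.ofReal (invGapSum ν i) := by
    rw [invGapSum, ENNReal.ofReal_sum_of_nonneg fun k _ => by positivity]
    refine Finset.sum_congr rfl fun k hk => ?_
    have hpos := sub_pos.2 (hgap k (Finset.ne_of_mem_erase hk))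
    rw [← ENNReal.ofReal_inv_of_pos hpos, ← ENNReal.ofReal_pow (by positivity), inv_pow]
  rw [heq] at hsum
  exact (ENNReal.ofReal_le_ofReal_iff hH).1 hsum

/-- Each of the `K - 1` gaps is at most `B`. -/
theorem le_of_mem_modelClass (hK : 0 < K) (hH : 0 ≤ H)
    (hν : ν ∈ modelClass K σ B H) : ((K : ℝ) - 1) / B ^ 2 ≤ H := by
  obtain ⟨i, hi, hG⟩ := exists_best_of_mem_modelClass hK hH hν
  refine le_trans ?_ hG
  have h := Finset.card_nsmul_le_sum (Finset.univ.erase i)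
    (fun k => ((armMean ν i - armMean ν k) ^ 2)⁻¹) (B ^ 2)⁻¹ fun k hk => by
      have hpos := sub_pos.2 (hi k (Finset.ne_of_mem_erase hk))
      have h1 := (hν.1 i).2.2
      have h2 := (hν.1 k).2.1
      gcongr
      linarith
  rw [Finset.card_erase_of_mem (Finset.mem_univ i), Finset.card_univ, Fintype.card_fin,
    nsmul_eq_mul, Nat.cast_pred hK] at h
  rwa [div_eq_mul_inv]

end ModelClass

/-! ### Numerical estimates -/

section Numerics

variable {K : ℕ} {σ c H : ℝ}

/-- The argument of the logarithm in the explicit bound. -/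
noncomputable def logArg (K : ℕ) (c : ℝ) : ℝ := K * Real.log K / (Real.exp 1 * c ^ 2)

theorem log_ge_of_two_le (hK : 2 ≤ K) : 0.69314 ≤ Real.log K := by
  have h2 : (2 : ℝ) ≤ K := by exact_mod_cast hK
  linarith [Real.log_two_gt_d9, Real.log_le_log (by norm_num) h2]

theorem mul_log_ge_of_two_le (hK : 2 ≤ K) : 1.38628 ≤ K * Real.log K := by
  have h2 : (2 : ℝ) ≤ K := by exact_mod_cast hK
  nlinarith [log_ge_of_two_le hK]

/-- At the extreme values `K = 2`, `c = 1/4` this reads `e³/16 ≤ 2 log 2`, about `1.26 ≤ 1.39`. -/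
theorem exp_two_le_logArg (hK : 2 ≤ K) (hc : 0 < c) (hc4 : c < 1 / 4) :
    Real.exp 2 ≤ logArg K c := by
  have he := Real.exp_one_lt_d9
  have he0 := Real.exp_pos 1
  have hexp : Real.exp 2 = Real.exp 1 ^ 2 := by rw [← Real.exp_nat_mul]; norm_num
  rw [logArg, hexp, le_div_iff₀ (by positivity)]
  refine le_trans ?_ (mul_log_ge_of_two_le hK)
  calc Real.exp 1 ^ 2 * (Real.exp 1 * c ^ 2) ≤ 2.7182818286 ^ 2 * (2.7182818286 * (1 / 4) ^ 2) := by
        gcongr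
    _ ≤ _ := by norm_num

theorem logArg_pos (hK : 2 ≤ K) (hc : 0 < c) (hc4 : c < 1 / 4) : 0 < logArg K c :=
  (Real.exp_pos 2).trans_le (exp_two_le_logArg hK hc hc4)

theorem two_le_log_logArg (hK : 2 ≤ K) (hc : 0 < c) (hc4 : c < 1 / 4) :
    2 ≤ Real.log (logArg K c) :=
  (Real.le_log_iff_exp_le (logArg_pos hK hc hc4)).2 (exp_two_le_logArg hK hc hc4)

theorem exp_neg_log_logArg_le (hK : 2 ≤ K) (hc : 0 < c) (hc4 : c < 1 / 4) :
    Real.exp (-Real.log (logArg K c)) ≤ c / 2 := by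
  have he := Real.exp_one_lt_d9
  have h1 := mul_log_ge_of_two_le hK
  rw [Real.exp_neg, Real.exp_log (logArg_pos hK hc hc4), logArg, inv_div,
    div_le_iff₀ (by linarith)]
  nlinarith

theorem confidence_eq (hc : 0 < c) : confidence K c = c / (1 + Real.log K / Real.exp 1) := by
  unfold confidence budget
  rw [div_eq_mul_inv]
  congr 2
  push_cast
  field_simp

theorem confidence_pos (hc : 0 < c) : 0 < confidence K c := by
  have := log_nat_nonneg K
  rw [confidence_eq hc]; positivity

theorem confidence_le (hc : 0 < c) : confidence K c ≤ c := by
  have := log_nat_nonneg K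
  rw [confidence_eq hc]
  exact div_le_self hc.le (le_add_of_nonneg_right (by positivity))

/-- This is what `δ` is tuned for: the factor on the left is the weight of the event that `i` is
beaten, `1` for the error and `(1 + log K)/e` for the cost of the pulls. -/
theorem confidence_mul_le (hc : 0 < c) :
    confidence K c * (1 + (1 + Real.log K) / Real.exp 1) ≤ 2 * c := by
  have h := log_nat_nonneg K
  have he : 1 ≤ Real.exp 1 := Real.one_le_exp zero_le_one
  rw [confidence_eq hc, div_mul_eq_mul_div, div_le_iff₀ (by positivity),
    show 2 * c * (1 + Real.log K / Real.exp 1) = c * (2 * (1 + Real.log K / Real.exp 1)) by ring]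
  gcongr
  have h1 : 1 / Real.exp 1 ≤ 1 := (div_le_one (by positivity)).2 he
  have h2 : 0 ≤ Real.log K / Real.exp 1 := by positivity
  rw [add_div]
  linarith

/-- Here `n ≤ 1.2/(ec)` and `1/δ ≤ 2 log K / c`, so the argument is at most `2.4 * logArg K c`,
hence at most the square of `logArg K c ≥ 7`. This is why `Λ = 2L` is admissible. -/
theorem log_div_confidence_le (hK : 2 ≤ K) (hc : 0 < c) (hc4 : c < 1 / 4) {n : ℕ}
    (hn : n ∈ Finset.Icc 1 (epochBound c)) :
    Real.log (K * n / confidence K c) ≤ 2 * Real.log (logArg K c) := by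
  have hR := logArg_pos hK hc hc4
  have hδ := confidence_pos (K := K) hc
  have hl := log_ge_of_two_le hK
  have hK0 : (0 : ℝ) < K := by exact_mod_cast (by omega : 0 < K)
  have he := Real.exp_one_lt_d9
  have he' := Real.exp_one_gt_d9
  have he0 := Real.exp_pos 1
  rw [Finset.mem_Icc] at hn
  have hn0 : (0 : ℝ) < n := by exact_mod_cast hn.1
  have hnle : (n : ℝ) ≤ budget c 2 + 1 := by
    have h1 : (n : ℝ) ≤ (⌊budget c 2⌋₊ + 1 : ℕ) := by exact_mod_cast hn.2
    push_cast at h1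
    linarith [Nat.floor_le (budget_pos hc (k := 2) (by norm_num)).le]
  have hn2 : (n : ℝ) ≤ 1.2 / (Real.exp 1 * c) := by
    refine hnle.trans ?_
    rw [le_div_iff₀ (by positivity)]
    unfold budget
    push_cast
    have : ((2 * Real.exp 1 * c)⁻¹ + 1) * (Real.exp 1 * c) = 1 / 2 + Real.exp 1 * c := by
      field_simp
    rw [this]
    nlinarith
  have hδ2 : (confidence K c)⁻¹ ≤ 2 * Real.log K / c := by
    rw [confidence_eq hc, inv_div]
    gcongr
    have h3 : Real.log K / Real.exp 1 ≤ Real.log K / 2 := by gcongr; linarith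
    linarith
  have h8 : 7 ≤ logArg K c := by
    have hexp : Real.exp 2 = Real.exp 1 ^ 2 := by rw [← Real.exp_nat_mul]; norm_num
    have := exp_two_le_logArg hK hc hc4
    nlinarith
  rw [← Real.log_rpow hR, Real.rpow_ofNat]
  refine Real.log_le_log (by positivity) ?_
  calc K * n / confidence K c = K * n * (confidence K c)⁻¹ := div_eq_mul_inv _ _
    _ ≤ K * (1.2 / (Real.exp 1 * c)) * (2 * Real.log K / c) := by gcongr
    _ = 2.4 * logArg K c := by unfold logArg; field_simp; ring
    _ ≤ logArg K c ^ 2 := by nlinarith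

/-- For `x ≤ exp (-r)` the logarithm `log (e/x)` is at least `1 + r`. -/
theorem mul_le_hardness (hσ : 0 < σ) (hc : 0 < c) (hH : 0 < H) {r : ℝ} (hr : 0 ≤ r)
    (hx : σ ^ 2 * c * H ≤ Real.exp (-r)) :
    (1 + r) / 4 * (σ ^ 2 * c * H) ≤ hardness σ c H := by
  have hx0 : 0 < σ ^ 2 * c * H := by positivity
  have hle : H ≤ (σ ^ 2 * c)⁻¹ := by
    rw [← one_div, le_div_iff₀ (by positivity), mul_comm]
    exact hx.trans (Real.exp_le_one_iff.2 (neg_nonpos.2 hr))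
  rw [hardness, if_pos hle, Real.log_div (Real.exp_ne_zero 1) hx0.ne', Real.log_exp]
  have := (Real.log_le_iff_le_exp hx0).2 hx
  nlinarith

theorem min_le_hardness (hσ : 0 < σ) (hc : 0 < c) (hH : 0 < H) :
    min (σ ^ 2 * c * H) 1 / 4 ≤ hardness σ c H := by
  by_cases hx : σ ^ 2 * c * H ≤ 1
  · have := mul_le_hardness hσ hc hH le_rfl (by simpa using hx)
    rw [min_eq_left hx]
    linarith
  · rw [hardness, if_neg, min_eq_right (not_le.1 hx).le]
    rw [← one_div, le_div_iff₀ (by positivity), mul_comm]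
    exact hx

theorem hardness_nonneg (hσ : 0 < σ) (hc : 0 < c) (hH : 0 < H) : 0 ≤ hardness σ c H :=
  le_trans (by positivity) (min_le_hardness hσ hc hH)

end Numerics

/-! ### The worst-case risk -/

section WorstCase

variable {K : ℕ} {σ B c H : ℝ} {ν : Model K}

/-- The constant `760` comes from here. The left side is at most `3.2 log K`, and `64e < 175` gives
`L * x ≥ 1/175`. For `x ≤ exp (-2)` the logarithm in `hardness` gains a factor `3`, so `L * hardness
≥ 3/700 ≥ 3.2/760`; for larger `x`, `hardness` is at least `1/32`. -/
theorem const_le_mul_hardness (hK : 2 ≤ K) (hσ : 0 < σ) (hc : 0 < c) (hH : 0 < H) {L : ℝ}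
    (hL : 2 ≤ L) (hx : 1 < 64 * Real.exp 1 * L * (σ ^ 2 * c * H)) :
    1 + (1 + Real.log K) / Real.exp 1 ≤ 760 * Real.log K * L * hardness σ c H := by
  have hl := log_ge_of_two_le hK
  have he := Real.exp_one_lt_d9
  have he' := Real.exp_one_gt_d9
  have hleft : 1 + (1 + Real.log K) / Real.exp 1 ≤ 3.2 * Real.log K := by
    have : (1 + Real.log K) / Real.exp 1 ≤ (1 + Real.log K) / 2 := by gcongr; linarith
    linarith
  refine hleft.trans ?_
  set x := σ ^ 2 * c * H with hxdef
  have hx0 : 0 < x := by positivity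
  have hLh : 3.2 / 760 ≤ L * hardness σ c H := by
    by_cases h8 : x ≤ Real.exp (-2)
    · have h := mul_le_hardness hσ hc hH zero_le_two h8
      rw [← hxdef] at h
      have hLx : 1 / 175 ≤ L * x := by
        have : 0 < L * x := by positivity
        nlinarith
      nlinarith
    · have hexp : (1 / 8 : ℝ) ≤ Real.exp (-2) := by
        rw [Real.exp_neg, show (2 : ℝ) = (2 : ℕ) * 1 by norm_num, Real.exp_nat_mul, ← one_div]
        gcongr
        nlinarith
      have hmin : 1 / 8 ≤ min x 1 := le_min (hexp.trans (not_le.1 h8).le) (by norm_num)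
      have := min_le_hardness hσ hc hH
      rw [← hxdef] at this
      nlinarith
  nlinarith

theorem dbcareRisk_le_of_mem (hK : 2 ≤ K) (hσ : 0 < σ) (hc : 0 < c) (hc4 : c < 1 / 4)
    (hH : 0 < H) (hν : ν ∈ modelClass K σ B H) :
    dbcareRisk (Nat.zero_lt_of_lt hK) (budget c) σ (confidence K c) c ν ≤
      ENNReal.ofReal (760 * Real.log K * Real.log (logArg K c) * hardness σ c H
        + (K + 1) * c) := by
  obtain ⟨i, hi, hG⟩ := exists_best_of_mem_modelClass (Nat.zero_lt_of_lt hK) hH.le hν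
  have hL := two_le_log_logArg hK hc hc4
  have hG0 := invGapSum_nonneg ν i
  set L := Real.log (logArg K c) with hLdef
  have hxdef : σ ^ 2 * c * invGapSum ν i ≤ σ ^ 2 * c * H := by gcongr
  -- The threshold is exactly the smallness condition on the gaps for `Λ = 2L`.
  by_cases hx : 64 * Real.exp 1 * L * (σ ^ 2 * c * H) ≤ 1
  · have he1 : 1 ≤ Real.exp 1 := Real.one_le_exp zero_le_one
    have hsmall : 32 * σ ^ 2 * (2 * L) * invGapSum ν i ≤ (Real.exp 1 * c)⁻¹ := by
      rw [← one_div, le_div_iff₀ (by positivity)]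
      calc 32 * σ ^ 2 * (2 * L) * invGapSum ν i * (Real.exp 1 * c)
          = 64 * Real.exp 1 * L * (σ ^ 2 * c * invGapSum ν i) := by ring
        _ ≤ 64 * Real.exp 1 * L * (σ ^ 2 * c * H) := by gcongr
        _ ≤ 1 := hx
    refine (dbcareRisk_le (Nat.zero_lt_of_lt hK) hσ hc (confidence_pos hc)
      ((confidence_le hc).trans (by linarith)) (fun a => (hν.1 a).1) hi (by positivity)
      (fun n hn => log_div_confidence_le hK hc hc4 hn) hsmall).trans (ENNReal.ofReal_le_ofReal ?_)
    have h2K : (2 : ℝ) ≤ K := by exact_mod_cast hK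
    have hlost : 4 * (confidence K c * (1 + (1 + Real.log K) / Real.exp 1)) / K ≤ 4 * c := by
      rw [div_le_iff₀ (by linarith)]
      nlinarith [confidence_mul_le (K := K) hc]
    have herr : Real.exp (-(2 * L / 2)) ≤ c / 2 := by
      rw [mul_div_cancel_left₀ L two_ne_zero]
      exact exp_neg_log_logArg_le hK hc hc4
    have hl := log_ge_of_two_le hK
    have hmain : 90 * L * (σ ^ 2 * c * H) ≤ 760 * Real.log K * L * hardness σ c H := by
      have h1 : 1 / 4 * (σ ^ 2 * c * H) ≤ hardness σ c H := by
        refine (le_of_eq ?_).trans (min_le_hardness hσ hc hH)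
        rw [min_eq_left]
        · ring
        · nlinarith [mul_le_mul he1 hL zero_le_two (by positivity),
            (by positivity : 0 < σ ^ 2 * c * H)]
      calc 90 * L * (σ ^ 2 * c * H) ≤ 760 * 0.69314 * L * (1 / 4 * (σ ^ 2 * c * H)) := by
            have : 0 < L * (σ ^ 2 * c * H) := by positivity
            nlinarith
        _ ≤ _ := by gcongr
    calc _ ≤ K * c + (4 * c + 32 * (c / 2) + 32 * (2 * L + 1) * c) * (σ ^ 2 * invGapSum ν i) := by
          gcongr
      _ = K * c + (64 * L + 52) * (σ ^ 2 * c * invGapSum ν i) := by ring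
      -- `52 ≤ 26 L`, since `L ≥ 2`.
      _ ≤ K * c + (90 * L) * (σ ^ 2 * c * H) := by gcongr; linarith
      _ ≤ _ := by linarith
  · refine (dbcareRisk_le_log _ hc).trans (ENNReal.ofReal_le_ofReal ?_)
    have := const_le_mul_hardness hK hσ hc hH hL (not_le.1 hx)
    linarith

theorem worstCaseRisk_le (hK : 2 ≤ K) (hσ : 0 < σ) (hc : 0 < c) (hc4 : c < 1 / 4)
    (hH : 0 < H) :
    worstCaseRisk (Nat.zero_lt_of_lt hK) σ B c H ≤
      ENNReal.ofReal (760 * Real.log K * Real.log (logArg K c) * hardness σ c H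
        + (K + 1) * c) :=
  iSup₂_le fun _ hν => dbcareRisk_le_of_mem hK hσ hc hc4 hH hν

theorem log_mul_log_logArg_le (hK : 2 ≤ K) (hc : 0 < c) (hc4 : c < 1 / 4) :
    Real.log K * Real.log (logArg K c) ≤ 2 * Real.log (K / c) ^ 2 := by
  have hK0 : (0 : ℝ) < K := by exact_mod_cast (by omega : 0 < K)
  have h1 : Real.log K ≤ Real.log (K / c) :=
    Real.log_le_log hK0 (by rw [le_div_iff₀ hc]; nlinarith)
  have h2 : Real.log (logArg K c) ≤ 2 * Real.log (K / c) := by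
    rw [← Real.log_rpow (by positivity), Real.rpow_ofNat]
    refine Real.log_le_log (logArg_pos hK hc hc4) ?_
    rw [logArg, div_pow, sq (K : ℝ)]
    have h3 : Real.log K ≤ K := (Real.log_le_sub_one_of_pos hK0).trans (by linarith)
    have h4 : c ^ 2 ≤ Real.exp 1 * c ^ 2 :=
      le_mul_of_one_le_left (by positivity) (Real.one_le_exp zero_le_one)
    gcongr
  have h0 := log_ge_of_two_le hK
  have hL := two_le_log_logArg hK hc hc4
  nlinarith

theorem one_le_log_div (hK : 2 ≤ K) (hc : 0 < c) (hc4 : c < 1 / 4) :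
    1 ≤ Real.log (K / c) := by
  have h2K : (2 : ℝ) ≤ K := by exact_mod_cast hK
  rw [Real.le_log_iff_exp_le (by positivity), le_div_iff₀ hc]
  nlinarith [Real.exp_one_lt_d9]

/-- The pulls of the first epoch are negligible if the class contains a model and `K * c` is
bounded. -/
theorem first_pulls_le (hK : 2 ≤ K) (hσ : 0 < σ) (hB : 0 < B) (hc : 0 < c) (hH : 0 < H) {L : ℝ}
    (hL : K * c ≤ L) (hKH : ((K : ℝ) - 1) / B ^ 2 ≤ H) :
    (K + 1) * c ≤ (12 * B ^ 2 / σ ^ 2 + 8 * L) * hardness σ c H := by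
  have h2K : (2 : ℝ) ≤ K := by exact_mod_cast hK
  have hL0 : 0 < L := lt_of_lt_of_le (by positivity) hL
  refine le_trans ?_ (mul_le_mul_of_nonneg_left (min_le_hardness hσ hc hH) (by positivity))
  -- For small `x` use `K + 1 ≤ 3(K - 1) ≤ 3B²H`, for large `x` use `(K + 1)c ≤ 2Kc ≤ 2L`.
  rcases le_total (σ ^ 2 * c * H) 1 with hx | hx
  · rw [min_eq_left hx]
    rw [div_le_iff₀ (by positivity)] at hKH
    have h1 : 12 * B ^ 2 / σ ^ 2 * (σ ^ 2 * c * H / 4) = 3 * c * (H * B ^ 2) := by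
      field_simp; ring
    have h2 : 0 ≤ 8 * L * (σ ^ 2 * c * H / 4) := by positivity
    rw [add_mul (12 * B ^ 2 / σ ^ 2), h1]
    nlinarith [mul_le_mul_of_nonneg_left hKH hc.le]
  · rw [min_eq_right hx, add_mul (12 * B ^ 2 / σ ^ 2)]
    have : 0 ≤ 12 * B ^ 2 / σ ^ 2 * (1 / 4) := by positivity
    nlinarith

end WorstCase

end Bandit

theorem theorem2 :
    -- the explicit bound
    (∀ (K : ℕ) (hK : 2 ≤ K) (σ B c H : ℝ), 0 < σ → 0 < B → 0 < c → c < 1 / 4 → 0 < H →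
      Bandit.worstCaseRisk (Nat.zero_lt_of_lt hK) σ B c H ≤
        ENNReal.ofReal
          (760 * Real.log K * Real.log (K * Real.log K / (Real.exp 1 * c ^ 2)) *
            Bandit.hardness σ c H + (K + 1) * c)) ∧
    -- the order of magnitude, with an absolute constant and the additive cost of first pulls
    (∃ C : ℝ, 0 < C ∧ ∀ (K : ℕ) (hK : 2 ≤ K) (σ B c H : ℝ),
      0 < σ → 0 < B → 0 < c → c < 1 / 4 → 0 < H →
      Bandit.worstCaseRisk (Nat.zero_lt_of_lt hK) σ B c H ≤
        ENNReal.ofReal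
          (C * Real.log (K / c) ^ 2 * Bandit.hardness σ c H + (K + 1) * c)) ∧
    -- the order of magnitude without additive term, uniformly in `K`, `c` and `H` as long as
    -- `K c` stays bounded
    (∀ σ B L : ℝ, 0 < σ → 0 < B → ∃ C : ℝ, 0 < C ∧ ∀ (K : ℕ) (hK : 2 ≤ K) (c H : ℝ),
      0 < c → c < 1 / 4 → K * c ≤ L → 0 < H →
      Bandit.worstCaseRisk (Nat.zero_lt_of_lt hK) σ B c H ≤
        ENNReal.ofReal (C * Real.log (K / c) ^ 2 * Bandit.hardness σ c H)) := by
  have hbound : ∀ (K : ℕ) (_ : 2 ≤ K) (σ c H : ℝ), 0 < σ → 0 < c → c < 1 / 4 → 0 < H →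
      760 * Real.log K * Real.log (Bandit.logArg K c) * Bandit.hardness σ c H ≤
        1520 * Real.log (K / c) ^ 2 * Bandit.hardness σ c H := by
    intro K hK σ c H hσ hc hc4 hH
    have h1 := Bandit.log_mul_log_logArg_le hK hc hc4
    have h2 := Bandit.hardness_nonneg hσ hc hH
    refine mul_le_mul_of_nonneg_right ?_ h2
    linarith
  refine ⟨fun K hK σ B c H hσ _ hc hc4 hH => Bandit.worstCaseRisk_le hK hσ hc hc4 hH,
    ⟨1520, by norm_num, fun K hK σ B c H hσ _ hc hc4 hH => ?_⟩, fun σ B L hσ hB => ?_⟩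
  · refine (Bandit.worstCaseRisk_le hK hσ hc hc4 hH).trans (ENNReal.ofReal_le_ofReal ?_)
    linarith [hbound K hK σ c H hσ hc hc4 hH]
  -- The absolute value keeps the constant positive when `L` is negative. The additive term gets the
  -- factor `log²(K/c)` for free, as this is at least `1`.
  · refine ⟨1520 + (12 * B ^ 2 / σ ^ 2 + 8 * |L|), by positivity, fun K hK c H hc hc4 hL hH => ?_⟩
    refine iSup₂_le fun ν hν =>
      (Bandit.dbcareRisk_le_of_mem hK hσ hc hc4 hH hν).trans (ENNReal.ofReal_le_ofReal ?_)
    have h1 := hbound K hK σ c H hσ hc hc4 hH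
    have h2 := Bandit.first_pulls_le hK hσ hB hc hH (hL.trans (le_abs_self L))
      (Bandit.le_of_mem_modelClass (Nat.zero_lt_of_lt hK) hH.le hν)
    have h3 : 1 ≤ Real.log (K / c) ^ 2 := one_le_pow₀ (Bandit.one_le_log_div hK hc hc4)
    have h4 : 0 ≤ (12 * B ^ 2 / σ ^ 2 + 8 * |L|) * Bandit.hardness σ c H :=
      mul_nonneg (by positivity) (Bandit.hardness_nonneg hσ hc hH)
    nlinarith [mul_le_mul_of_nonneg_left h3 h4]
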